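/- For elements $a,b$ of a semigroup, $b$ is an inverse of $a$ if $aba=a$ and $bab=b$. A semigroup is regular if every element $a$ satisfies $a=axa$ for some $x$; orthodox if it is regular and its idempotents form a subsemigroup; inverse if every element has exactly one inverse; left inverse (respectively right inverse) if it is regular and every $\mathcal R$-class (respectively $\mathcal L$-class) contains exactly one idempotent. An inverse transversal of a semigroup $S$ is an inverse subsemigroup $S^0$ of $S$ such that every $x\in S$ has exactly one inverse $x^0$ in $S^0$; write $x^{00}=(x^0)^0$. It is a quasi-ideal if $S^0SS^0\subseteq S^0$. (1) Let $L$ be a left inverse semigroup and $R$ a right inverse semigroup with a common quasi-ideal inverse transversal $S^0$ (that is, $S^0$ is embedded in both $L$ and $R$ as a quasi-ideal inverse transversal). Then the spined product $$L|\times|R=\{(x,a)\in L\times R : x^0=a^0\}$$ is closed under the multiplication $$(x,a)(y,b)=(xy^{00},\,a^{00}b)$$ and is an orthodox semigroup under it. Moreover $\{(s,s):s\in S^0\}$ is a quasi-ideal inverse transversal of $L|\times|R$, and $s\mapsto(s,s)$ is an isomorphism of $S^0$ onto it. (2) Conversely, let $S$ be an orthodox semigroup with a quasi-ideal inverse transversal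 $S^0$. Then there are subsemigroups $L$ and $R$ of $S$, both containing $S^0$, such that $L$ is left inverse, $R$ is right inverse, $S^0$ is a quasi-ideal inverse transversal of both $L$ and $R$, and there is an isomorphism of $S$ onto the spined product $L|\times|R$ of (1) that maps each $s\in S^0$ to $(s,s)$. -/

import Mathlib

namespace InvTrans

/-- `b` is an inverse of `a`, i.e. `b ∈ V(a)`. -/
def IsInverseOf {S : Type*} [Semigroup S] (b a : S) : Prop :=
  a * b * a = a ∧ b * a * b = b

/-- Every element `a` is regular: `a = a x a` for some `x`. -/
def IsRegularSemigroup (S : Type*) [Semigroup S] : Prop :=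
  ∀ a : S, ∃ x : S, a * x * a = a

/-- Every element has exactly one inverse. -/
def IsInverseSemigroup (S : Type*) [Semigroup S] : Prop :=
  ∀ a : S, ∃! b : S, IsInverseOf b a

/-- A regular semigroup whose idempotents form a subsemigroup. -/
structure IsOrthodox (S : Type*) [Semigroup S] : Prop where
  regular : IsRegularSemigroup S
  idem_mul : ∀ e f : S, IsIdempotentElem e → IsIdempotentElem f → IsIdempotentElem (e * f)

/-- Green's relation `𝓡`: `a S¹ = b S¹`. -/
def GreenR {S : Type*} [Semigroup S] (a b : S) : Prop :=
  a = b ∨ ((∃ u : S, a = b * u) ∧ ∃ v : S, b = a * v)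

/-- Green's relation `𝓛`: `S¹ a = S¹ b`. -/
def GreenL {S : Type*} [Semigroup S] (a b : S) : Prop :=
  a = b ∨ ((∃ u : S, a = u * b) ∧ ∃ v : S, b = v * a)

/-- A regular semigroup in which every `𝓡`-class contains a unique idempotent. -/
structure IsLeftInverse (S : Type*) [Semigroup S] : Prop where
  regular : IsRegularSemigroup S
  existsUnique_idem : ∀ a : S, ∃! e : S, IsIdempotentElem e ∧ GreenR a e

/-- A regular semigroup in which every `𝓛`-class contains a unique idempotent. -/
structure IsRightInverse (S : Type*) [Semigroup S] : Prop where
  regular : IsRegularSemigroup S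
  existsUnique_idem : ∀ a : S, ∃! e : S, IsIdempotentElem e ∧ GreenL a e

/-- `T` is an inverse transversal of `S`: an inverse subsemigroup containing exactly one inverse
of each element of `S`. -/
structure IsInverseTransversal {S : Type*} [Semigroup S] (T : Subsemigroup S) : Prop where
  inverse : IsInverseSemigroup T
  existsUnique_inverse : ∀ x : S, ∃! y : S, y ∈ T ∧ IsInverseOf y x

/-- An inverse transversal `T` with `T S T ⊆ T`. -/
structure IsQuasiIdealInverseTransversal {S : Type*} [Semigroup S] (T : Subsemigroup S) : Prop
    extends IsInverseTransversal T where
  quasiIdeal : ∀ s ∈ T, ∀ x : S, ∀ t ∈ T, s * x * t ∈ T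

/-- `S₀`, embedded in `S` by `i`, is a quasi-ideal inverse transversal of `S`. -/
structure IsTransversalEmbedding {S₀ S : Type*} [Semigroup S₀] [Semigroup S] (i : S₀ →ₙ* S) :
    Prop where
  injective : Function.Injective i
  transversal : IsQuasiIdealInverseTransversal i.srange

theorem IsTransversalEmbedding.exists_inverse {S₀ S : Type*} [Semigroup S₀] [Semigroup S]
    {i : S₀ →ₙ* S} (hi : IsTransversalEmbedding i) (x : S) : ∃ s : S₀, IsInverseOf (i s) x := by
  obtain ⟨_, ⟨⟨s, rfl⟩, hs⟩, _⟩ := hi.transversal.existsUnique_inverse x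
  exact ⟨s, hs⟩

/-- `x⁰`: the element of `S₀` that is an inverse of `x` (unique as `i` is injective). -/
noncomputable def star {S₀ S : Type*} [Semigroup S₀] [Semigroup S]
    {i : S₀ →ₙ* S} (hi : IsTransversalEmbedding i) (x : S) : S₀ :=
  (hi.exists_inverse x).choose

/-- `x⁰⁰ = (x⁰)⁰`. -/
noncomputable def starStar {S₀ S : Type*} [Semigroup S₀] [Semigroup S]
    {i : S₀ →ₙ* S} (hi : IsTransversalEmbedding i) (x : S) : S₀ :=
  star hi (i (star hi x))

/-- The set `{(x, a) ∈ L × R : x⁰ = a⁰}`. -/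
abbrev SpinedProduct {S₀ L R : Type*} [Semigroup S₀] [Semigroup L] [Semigroup R]
    {i : S₀ →ₙ* L} {j : S₀ →ₙ* R}
    (hi : IsTransversalEmbedding i) (hj : IsTransversalEmbedding j) : Type _ :=
  {p : L × R // star hi p.1 = star hj p.2}

/-- The pair `(x y⁰⁰, a⁰⁰ b)` formed from `(x, a)` and `(y, b)`. -/
noncomputable def spinedMul {S₀ L R : Type*} [Semigroup S₀] [Semigroup L] [Semigroup R]
    {i : S₀ →ₙ* L} {j : S₀ →ₙ* R}
    (hi : IsTransversalEmbedding i) (hj : IsTransversalEmbedding j) (p q : L × R) : L × R :=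
  (p.1 * i (starStar hi q.1), j (starStar hj p.2) * q.2)

end InvTrans

/-! Spined products of left and right inverse semigroups over a common quasi-ideal inverse
transversal. -/

/-! In an orthodox semigroup `b⁰a⁰` is an inverse of `ab`, so `x ↦ x⁰` reverses products and `x ↦
x⁰⁰` is a homomorphic retraction onto `S⁰` (`starStar_mul`). Left and right inverse semigroups are
orthodox, so this applies to both factors. Closure and associativity of the spined product follow at
once; the identities `x x⁰ x⁰⁰ = x` in `L` and `a⁰⁰ a⁰ a = a` in `R` make `(x⁰, x⁰)` an inverse of
`(x, a)`.

For the converse, the quasi-ideal property gives `s x t = s x⁰⁰ t` for `s`, `t` in `S⁰`. Take for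
`L` and `R` the sets where those two identities hold. The map `x ↦ (x x⁰ x⁰⁰, x⁰⁰ x⁰ x)` is then
multiplicative (`leftProj_mul`, `rightProj_mul`), and `(u, v) ↦ u u⁰ v` recovers `x`. -/

namespace InvTrans

/-! ### Inverses, idempotents and orthodoxy -/

section Basic

variable {S : Type*} [Semigroup S]

theorem IsInverseOf.symm {a b : S} (h : IsInverseOf b a) : IsInverseOf a b := ⟨h.2, h.1⟩

theorem IsInverseOf.isIdempotentElem_mul {a b : S} (h : IsInverseOf b a) :
    IsIdempotentElem (a * b) := by
  unfold IsIdempotentElem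
  rw [← mul_assoc, h.1]

theorem isInverseOf_map_iff {T : Type*} [Semigroup T] {f : S →ₙ* T}
    (hf : Function.Injective f) {a b : S} : IsInverseOf (f b) (f a) ↔ IsInverseOf b a := by
  simp only [IsInverseOf, ← map_mul, hf.eq_iff]

theorem IsInverseSemigroup.congr {T : Type*} [Semigroup T] (e : S ≃* T)
    (h : IsInverseSemigroup S) : IsInverseSemigroup T := by
  have key : ∀ a b : T, IsInverseOf (e.symm b) (e.symm a) ↔ IsInverseOf b a := fun a b =>
    isInverseOf_map_iff (f := e.symm.toMulHom) e.symm.injective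
  intro a
  obtain ⟨b, hb, hu⟩ := h (e.symm a)
  refine ⟨e b, (key _ _).1 (by simpa using hb), fun c hc => ?_⟩
  rw [← hu _ ((key _ _).2 hc), MulEquiv.apply_symm_apply]

/-- In an orthodox semigroup, `b'a'` is an inverse of `ab`. -/
theorem IsOrthodox.isInverseOf_mul (h : IsOrthodox S) {a b a' b' : S}
    (ha : IsInverseOf a' a) (hb : IsInverseOf b' b) : IsInverseOf (b' * a') (a * b) := by
  have h1 := h.idem_mul _ _ ha.symm.isIdempotentElem_mul hb.isIdempotentElem_mul
  have h2 := h.idem_mul _ _ hb.isIdempotentElem_mul ha.symm.isIdempotentElem_mul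
  unfold IsIdempotentElem at h1 h2
  obtain ⟨ha1, ha2⟩ := ha
  obtain ⟨hb1, hb2⟩ := hb
  constructor
  · calc a * b * (b' * a') * (a * b)
        = (a * a' * a) * b * (b' * a') * (a * (b * b' * b)) := by rw [ha1, hb1]
      _ = a * ((a' * a) * (b * b') * ((a' * a) * (b * b'))) * b := by simp only [mul_assoc]
      _ = (a * a' * a) * (b * b' * b) := by rw [h1]; simp only [mul_assoc]
      _ = a * b := by rw [ha1, hb1]
  · calc b' * a' * (a * b) * (b' * a')
        = (b' * b * b') * a' * (a * b) * (b' * (a' * a * a')) := by rw [ha2, hb2]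
      _ = b' * ((b * b') * (a' * a) * ((b * b') * (a' * a))) * a' := by simp only [mul_assoc]
      _ = (b' * b * b') * (a' * a * a') := by rw [h2]; simp only [mul_assoc]
      _ = b' * a' := by rw [ha2, hb2]

theorem IsLeftInverse.idem_eq (h : IsLeftInverse S) {e f : S} (he : IsIdempotentElem e)
    (hf : IsIdempotentElem f) (h1 : e * f = f) (h2 : f * e = e) : e = f :=
  (h.existsUnique_idem e).unique ⟨he, Or.inl rfl⟩ ⟨hf, Or.inr ⟨⟨e, h2.symm⟩, ⟨f, h1.symm⟩⟩⟩

theorem IsRightInverse.idem_eq (h : IsRightInverse S) {e f : S} (he : IsIdempotentElem e)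
    (hf : IsIdempotentElem f) (h1 : e * f = e) (h2 : f * e = f) : e = f :=
  (h.existsUnique_idem e).unique ⟨he, Or.inl rfl⟩ ⟨hf, Or.inr ⟨⟨e, h1.symm⟩, ⟨f, h2.symm⟩⟩⟩

/-- Every product `ef` of idempotents has an idempotent inverse `g` with `fg = g = ge`. -/
theorem IsRegularSemigroup.exists_idem_inverse (h : IsRegularSemigroup S) {e f : S}
    (he : IsIdempotentElem e) (hf : IsIdempotentElem f) :
    ∃ g : S, IsIdempotentElem g ∧ f * g = g ∧ g * e = g ∧ e * f * g * (e * f) = e * f := by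
  obtain ⟨x, hx⟩ := h (e * f)
  have he' := he.eq
  have hf' := hf.eq
  -- Replacing `x` by `x(ef)x` makes it a genuine inverse `x'` of `ef`; then `f x' e` is idempotent.
  refine ⟨f * (x * e * f * x) * e, ?_, ?_, ?_, ?_⟩
  · unfold IsIdempotentElem; grind
  all_goals grind

/-- The idempotents `g` and `gf` are `𝓡`-related, hence equal. Then `ef = efgef = efgf = efg`, so
`efef = efgef = ef`. -/
theorem IsLeftInverse.isOrthodox (h : IsLeftInverse S) : IsOrthodox S := by
  refine ⟨h.regular, fun e f he hf => ?_⟩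
  obtain ⟨g, hg, hfg, hge, hefg⟩ := h.regular.exists_idem_inverse he hf
  have hg' := hg.eq
  have hgf : g = g * f := h.idem_eq hg (by unfold IsIdempotentElem; grind) (by grind) (by grind)
  unfold IsIdempotentElem
  grind

theorem IsRightInverse.isOrthodox (h : IsRightInverse S) : IsOrthodox S := by
  refine ⟨h.regular, fun e f he hf => ?_⟩
  obtain ⟨g, hg, hfg, hge, hefg⟩ := h.regular.exists_idem_inverse he hf
  have hg' := hg.eq
  have heg : g = e * g := h.idem_eq hg (by unfold IsIdempotentElem; grind) (by grind) (by grind)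
  unfold IsIdempotentElem
  grind

end Basic

/-! ### The maps `x ↦ x⁰` and `x ↦ x⁰⁰` -/

section Star

variable {S₀ S : Type*} [Semigroup S₀] [Semigroup S] {i : S₀ →ₙ* S}

theorem star_spec (hi : IsTransversalEmbedding i) (x : S) : IsInverseOf (i (star hi x)) x :=
  (hi.exists_inverse x).choose_spec

theorem star_eq_of_isInverseOf (hi : IsTransversalEmbedding i) {x : S} {s : S₀}
    (h : IsInverseOf (i s) x) : star hi x = s :=
  hi.injective <| (hi.transversal.existsUnique_inverse x).unique
    ⟨⟨_, rfl⟩, star_spec hi x⟩ ⟨⟨_, rfl⟩, h⟩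

theorem star_map_eq_of_isInverseOf (hi : IsTransversalEmbedding i) {s t : S₀}
    (h : IsInverseOf t s) : star hi (i s) = t :=
  star_eq_of_isInverseOf hi ((isInverseOf_map_iff hi.injective).2 h)

theorem isInverseOf_star_map (hi : IsTransversalEmbedding i) (s : S₀) :
    IsInverseOf (star hi (i s)) s :=
  (isInverseOf_map_iff hi.injective).1 (star_spec hi (i s))

theorem isInverseOf_star_starStar (hi : IsTransversalEmbedding i) (x : S) :
    IsInverseOf (star hi x) (starStar hi x) :=
  (isInverseOf_star_map hi _).symm

theorem starStar_map (hi : IsTransversalEmbedding i) (s : S₀) : starStar hi (i s) = s :=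
  star_map_eq_of_isInverseOf hi (isInverseOf_star_map hi s).symm

theorem star_map_starStar (hi : IsTransversalEmbedding i) (x : S) :
    star hi (i (starStar hi x)) = star hi x :=
  starStar_map hi (star hi x)

theorem star_mul (hi : IsTransversalEmbedding i) (h : IsOrthodox S) (x y : S) :
    star hi (x * y) = star hi y * star hi x := by
  apply star_eq_of_isInverseOf
  rw [map_mul]
  exact h.isInverseOf_mul (star_spec hi x) (star_spec hi y)

theorem starStar_mul (hi : IsTransversalEmbedding i) (h : IsOrthodox S) (x y : S) :
    starStar hi (x * y) = starStar hi x * starStar hi y := by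
  unfold starStar
  rw [star_mul hi h, map_mul, star_mul hi h]

theorem isInverseSemigroup_of_isTransversalEmbedding (hi : IsTransversalEmbedding i) :
    IsInverseSemigroup S₀ := fun s =>
  ⟨star hi (i s), isInverseOf_star_map hi s, fun _ ht => (star_map_eq_of_isInverseOf hi ht).symm⟩

/-- The idempotents `x⁰x` and `x⁰x⁰⁰` are `𝓡`-related, hence equal, and `x x⁰ x = x`. -/
theorem IsLeftInverse.mul_star_mul_starStar (hi : IsTransversalEmbedding i) (h : IsLeftInverse S)
    (x : S) : x * i (star hi x) * i (starStar hi x) = x := by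
  have h1 := star_spec hi x
  have h2 := star_spec hi (i (star hi x))
  have := h.idem_eq h1.symm.isIdempotentElem_mul h2.isIdempotentElem_mul
    (by rw [← mul_assoc, h1.2]) (by rw [← mul_assoc, h2.1])
  unfold starStar
  rw [mul_assoc, ← this, ← mul_assoc, h1.1]

theorem IsRightInverse.starStar_mul_star_mul (hi : IsTransversalEmbedding i)
    (h : IsRightInverse S) (x : S) : i (starStar hi x) * i (star hi x) * x = x := by
  have h1 := star_spec hi x
  have h2 := star_spec hi (i (star hi x))
  have := h.idem_eq h1.isIdempotentElem_mul h2.symm.isIdempotentElem_mul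
    (by rw [mul_assoc, ← mul_assoc (i (star hi x)) (i _), h2.1])
    (by rw [mul_assoc, ← mul_assoc (i (star hi x)) x, h1.2])
  unfold starStar
  rw [← this, h1.1]

end Star

/-! ### The spined product -/

section Spined

variable {S₀ L R : Type*} [Semigroup S₀] [Semigroup L] [Semigroup R]
  {i : S₀ →ₙ* L} {j : S₀ →ₙ* R}
  {hi : IsTransversalEmbedding i} {hj : IsTransversalEmbedding j}

theorem SpinedProduct.starStar_eq (p : SpinedProduct hi hj) :
    starStar hi p.val.1 = starStar hj p.val.2 := by
  apply star_map_eq_of_isInverseOf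
  rw [p.2]
  exact isInverseOf_star_map hj _

/-- The multiplication `(x, a)(y, b) = (x y⁰⁰, a⁰⁰ b)` on the spined product. -/
noncomputable abbrev spinedSemigroup (hL : IsOrthodox L) (hR : IsOrthodox R)
    (hi : IsTransversalEmbedding i) (hj : IsTransversalEmbedding j) :
    Semigroup (SpinedProduct hi hj) where
  mul p q := ⟨spinedMul hi hj p.val q.val, by
    simp only [spinedMul]
    rw [star_mul hi hL, star_mul hj hR, star_map_starStar, star_map_starStar, p.2, q.2]⟩
  mul_assoc p q r := by
    apply Subtype.ext
    change spinedMul hi hj (spinedMul hi hj p.val q.val) r.val =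
      spinedMul hi hj p.val (spinedMul hi hj q.val r.val)
    simp only [spinedMul, starStar_mul hi hL, starStar_mul hj hR, starStar_map, map_mul, mul_assoc]

/-- The element `(s, s)` of the spined product. -/
def spinedDiag (hi : IsTransversalEmbedding i) (hj : IsTransversalEmbedding j) (s : S₀) :
    SpinedProduct hi hj :=
  ⟨(i s, j s), (star_map_eq_of_isInverseOf hi (isInverseOf_star_map hj s))⟩

/-- Each `p` has the diagonal inverse `(x⁰, x⁰)`, which gives regularity and the existence half of
the transversal property. -/
theorem spinedProduct_structure (hL : IsLeftInverse L) (hR : IsRightInverse R) :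
    letI := spinedSemigroup hL.isOrthodox hR.isOrthodox hi hj
    IsOrthodox (SpinedProduct hi hj) ∧
      ∃ T : Subsemigroup (SpinedProduct hi hj), IsQuasiIdealInverseTransversal T ∧
        ∃ ψ : S₀ ≃* T, ∀ s : S₀, (ψ s).val.val = (i s, j s) := by
  let := spinedSemigroup hL.isOrthodox hR.isOrthodox hi hj
  have mul_fst : ∀ p q : SpinedProduct hi hj,
    (p * q).val.1 = p.val.1 * i (starStar hi q.val.1) := fun _ _ => rfl
  have mul_snd : ∀ p q : SpinedProduct hi hj,
    (p * q).val.2 = j (starStar hj p.val.2) * q.val.2 := fun _ _ => rfl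
  have diag_fst : ∀ s, (spinedDiag hi hj s).val.1 = i s := fun _ => rfl
  have diag_snd : ∀ s, (spinedDiag hi hj s).val.2 = j s := fun _ => rfl
  have ext_iff : ∀ p q : SpinedProduct hi hj,
      p = q ↔ p.val.1 = q.val.1 ∧ p.val.2 = q.val.2 := fun p q => by
    rw [Subtype.ext_iff, Prod.ext_iff]
  have inv_star : ∀ p : SpinedProduct hi hj,
      IsInverseOf (spinedDiag hi hj (star hi p.val.1)) p := by
    intro p
    have h := isInverseOf_star_starStar hi p.val.1
    have h1 := hL.mul_star_mul_starStar hi p.val.1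
    have h2 := hR.starStar_mul_star_mul hj p.val.2
    rw [IsInverseOf, ext_iff, ext_iff]
    simp only [mul_fst, mul_snd, diag_fst, diag_snd, starStar_map, starStar_mul hj hR.isOrthodox,
      ← map_mul, ← p.starStar_eq]
    refine ⟨⟨h1, ?_⟩, by rw [h.2], by rw [h.2]⟩
    rw [map_mul, p.starStar_eq, p.2, h2]
  have diag_mul : ∀ s t, spinedDiag hi hj (s * t) = spinedDiag hi hj s * spinedDiag hi hj t := by
    intro s t
    rw [ext_iff]
    simp only [mul_fst, mul_snd, diag_fst, diag_snd, starStar_map, map_mul, and_self]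
  let δ : S₀ →ₙ* SpinedProduct hi hj := ⟨spinedDiag hi hj, diag_mul⟩
  have δ_inj : Function.Injective δ := fun s t hst => hi.injective ((ext_iff _ _).1 hst).1
  let ψ : S₀ ≃* δ.srange := MulEquiv.ofBijective δ.srangeRestrict
    ⟨fun s t hst => δ_inj (congrArg Subtype.val hst), δ.srangeRestrict_surjective⟩
  refine ⟨⟨fun p => ⟨_, (inv_star p).1⟩, fun p q hp hq => ?_⟩, δ.srange,
    ⟨⟨(isInverseSemigroup_of_isTransversalEmbedding hi).congr ψ, fun p =>
      ⟨_, ⟨⟨_, rfl⟩, inv_star p⟩, ?_⟩⟩, ?_⟩, ψ, fun s => rfl⟩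
  -- Idempotency of `(x, a)` says `x x⁰⁰ = x` and `a⁰⁰ a = a`, and forces `x⁰⁰`, `a⁰⁰` to be
  -- idempotent. The claim then reduces to idempotency of `x⁰⁰y⁰⁰` in `L` and of its counterpart in
  -- `R`.
  · unfold IsIdempotentElem at hp hq ⊢
    rw [ext_iff] at hp hq ⊢
    simp only [mul_fst, mul_snd] at hp hq ⊢
    have hpL := congrArg (starStar hi) hp.1
    have hqL := congrArg (starStar hi) hq.1
    have hpR := congrArg (starStar hj) hp.2
    have hqR := congrArg (starStar hj) hq.2
    simp only [starStar_mul hi hL.isOrthodox, starStar_mul hj hR.isOrthodox, starStar_map]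
      at hpL hqL hpR hqR ⊢
    have h1 := (hL.isOrthodox.idem_mul (i (starStar hi p.val.1)) (i (starStar hi q.val.1))
      (by rw [IsIdempotentElem, ← map_mul, hpL]) (by rw [IsIdempotentElem, ← map_mul, hqL])).eq
    have h2 := (hR.isOrthodox.idem_mul (j (starStar hj p.val.2)) (j (starStar hj q.val.2))
      (by rw [IsIdempotentElem, ← map_mul, hpR]) (by rw [IsIdempotentElem, ← map_mul, hqR])).eq
    simp only [map_mul]
    constructor
    · grind
    · grind
  · rintro _ ⟨⟨s, rfl⟩, hs⟩
    -- Applying `⁰⁰` to the first coordinates moves the inverse relation into `S₀`, where `x⁰⁰` has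
    -- the unique inverse `x⁰`.
    have h : IsInverseOf s (starStar hi p.val.1) := by
      rw [IsInverseOf, ext_iff, ext_iff] at hs
      have h1 := congrArg (starStar hi) hs.1.1
      have h2 := congrArg (starStar hi) hs.2.1
      change starStar hi (p.val.1 * i (starStar hi (i s)) * _) = _ at h1
      change starStar hi (i s * i (starStar hi p.val.1) * i (starStar hi (i s))) =
        starStar hi (i s) at h2
      simp only [starStar_mul hi hL.isOrthodox, starStar_map] at h1 h2
      exact ⟨h1, h2⟩
    change spinedDiag hi hj s = spinedDiag hi hj _
    rw [← star_map_starStar, star_map_eq_of_isInverseOf hi h]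
  · rintro _ ⟨s, rfl⟩ p _ ⟨t, rfl⟩
    -- Between two diagonal factors only `p⁰⁰` survives, in both coordinates.
    refine ⟨s * starStar hi p.val.1 * t, ?_⟩
    change spinedDiag hi hj _ = spinedDiag hi hj s * p * spinedDiag hi hj t
    rw [ext_iff]
    simp only [mul_fst, mul_snd, diag_fst, diag_snd, starStar_map, starStar_mul hj hR.isOrthodox,
      map_mul, p.starStar_eq, and_self]

end Spined

/-! ### Decomposing an orthodox semigroup -/

section Decomposition

variable {S : Type*} [Semigroup S] {S₀ : Subsemigroup S}

theorem isTransversalEmbedding_inclusion (hT : IsQuasiIdealInverseTransversal S₀)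
    {L : Subsemigroup S} (hL : S₀ ≤ L) :
    IsTransversalEmbedding (Subsemigroup.inclusion hL) := by
  have hinj : Function.Injective (Subsemigroup.inclusion hL) := fun _ _ h =>
    Subtype.ext (congrArg (fun z : L => (z : S)) h)
  let e : S₀ ≃* (Subsemigroup.inclusion hL).srange :=
    MulEquiv.ofBijective (Subsemigroup.inclusion hL).srangeRestrict
      ⟨fun s t hst => hinj (congrArg Subtype.val hst),
        (Subsemigroup.inclusion hL).srangeRestrict_surjective⟩
  refine ⟨hinj, ⟨⟨hT.inverse.congr e, fun x => ?_⟩, ?_⟩⟩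
  · obtain ⟨y, ⟨hy, hyx⟩, hu⟩ := hT.existsUnique_inverse x
    refine ⟨⟨y, hL hy⟩, ⟨⟨⟨y, hy⟩, rfl⟩,
      (isInverseOf_map_iff (f := MulMemClass.subtype L) Subtype.val_injective).1 hyx⟩, ?_⟩
    rintro _ ⟨⟨s, rfl⟩, hs⟩
    exact Subtype.ext (hu _ ⟨s.2,
      (isInverseOf_map_iff (f := MulMemClass.subtype L) Subtype.val_injective).2 hs⟩)
  · rintro _ ⟨s, rfl⟩ x _ ⟨t, rfl⟩
    exact ⟨⟨_, hT.quasiIdeal s s.2 x t t.2⟩, rfl⟩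

theorem isTransversalEmbedding_subtype (hT : IsQuasiIdealInverseTransversal S₀) :
    IsTransversalEmbedding (MulMemClass.subtype S₀) := by
  have hr : (MulMemClass.subtype S₀).srange = S₀ := by
    ext x
    exact ⟨fun ⟨s, hs⟩ => hs ▸ s.2, fun hx => ⟨⟨x, hx⟩, rfl⟩⟩
  exact ⟨Subtype.val_injective, hr.symm ▸ hT⟩

/-- `x⁰` as an element of the ambient semigroup. -/
noncomputable def coeStar (hT : IsQuasiIdealInverseTransversal S₀) (x : S) : S :=
  (star (isTransversalEmbedding_subtype hT) x).val

/-- `x⁰⁰` as an element of the ambient semigroup. -/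
noncomputable def coeStarStar (hT : IsQuasiIdealInverseTransversal S₀) (x : S) : S :=
  (starStar (isTransversalEmbedding_subtype hT) x).val

section

variable (hT : IsQuasiIdealInverseTransversal S₀)

theorem coeStar_mem (x : S) : coeStar hT x ∈ S₀ := Subtype.prop _

theorem coeStarStar_mem (x : S) : coeStarStar hT x ∈ S₀ := Subtype.prop _

theorem coeStar_spec (x : S) : IsInverseOf (coeStar hT x) x :=
  star_spec (isTransversalEmbedding_subtype hT) x

theorem coeStar_eq {x s : S} (hs : s ∈ S₀) (h : IsInverseOf s x) : coeStar hT x = s :=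
  congrArg Subtype.val <| star_eq_of_isInverseOf (isTransversalEmbedding_subtype hT) (s := ⟨s, hs⟩) h

theorem isInverseOf_coeStar_coeStarStar (x : S) :
    IsInverseOf (coeStar hT x) (coeStarStar hT x) :=
  (coeStar_spec hT (coeStar hT x)).symm

theorem coeStarStar_of_mem {s : S} (hs : s ∈ S₀) : coeStarStar hT s = s :=
  coeStar_eq hT hs (coeStar_spec hT s).symm

theorem coeStar_mul (hS : IsOrthodox S) (x y : S) :
    coeStar hT (x * y) = coeStar hT y * coeStar hT x :=
  congrArg Subtype.val (star_mul (isTransversalEmbedding_subtype hT) hS x y)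

theorem coeStarStar_mul (hS : IsOrthodox S) (x y : S) :
    coeStarStar hT (x * y) = coeStarStar hT x * coeStarStar hT y :=
  congrArg Subtype.val (starStar_mul (isTransversalEmbedding_subtype hT) hS x y)

theorem coeStar_coeStarStar (x : S) : coeStar hT (coeStarStar hT x) = coeStar hT x :=
  coeStarStar_of_mem hT (coeStar_mem hT x)

theorem coe_star_inclusion {L : Subsemigroup S} (hL : S₀ ≤ L) (x : L) :
    (star (isTransversalEmbedding_inclusion hT hL) x).val = coeStar hT x := by
  refine (coeStar_eq hT (Subtype.prop _) ?_).symm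
  exact (isInverseOf_map_iff (f := MulMemClass.subtype L) Subtype.val_injective).2
    (star_spec (isTransversalEmbedding_inclusion hT hL) x)

theorem coe_starStar_inclusion {L : Subsemigroup S} (hL : S₀ ≤ L) (x : L) :
    (starStar (isTransversalEmbedding_inclusion hT hL) x).val = coeStarStar hT x := by
  unfold starStar
  rw [coe_star_inclusion]
  exact congrArg (coeStar hT) (coe_star_inclusion hT hL x)

/-- `s x t = s x⁰⁰ t` for `s`, `t` in the transversal. -/
theorem mul_mul_eq_mul_coeStarStar_mul (hS : IsOrthodox S) {s t : S} (hs : s ∈ S₀) (ht : t ∈ S₀)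
    (x : S) : s * x * t = s * coeStarStar hT x * t := by
  -- The product `s x t` lies in `S₀`, so the retraction `⁰⁰` fixes it, as it fixes `s` and `t`.
  have h := coeStarStar_of_mem hT (hT.quasiIdeal s hs x t ht)
  rw [coeStarStar_mul hT hS, coeStarStar_mul hT hS, coeStarStar_of_mem hT hs,
    coeStarStar_of_mem hT ht] at h
  exact h.symm

/-- The component `x x⁰ x⁰⁰` of `x`. -/
noncomputable def leftProj (x : S) : S := x * coeStar hT x * coeStarStar hT x

/-- The component `x⁰⁰ x⁰ x` of `x`. -/
noncomputable def rightProj (x : S) : S := coeStarStar hT x * coeStar hT x * x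

theorem coeStar_leftProj (hS : IsOrthodox S) (x : S) :
    coeStar hT (leftProj hT x) = coeStar hT x := by
  have h := (isInverseOf_coeStar_coeStarStar hT x).2
  rw [leftProj, coeStar_mul hT hS, coeStar_mul hT hS, coeStar_coeStarStar]
  change _ * (coeStarStar hT x * _) = _
  rw [← mul_assoc, h]

theorem coeStar_rightProj (hS : IsOrthodox S) (x : S) :
    coeStar hT (rightProj hT x) = coeStar hT x := by
  have h := (isInverseOf_coeStar_coeStarStar hT x).2
  rw [rightProj, coeStar_mul hT hS, coeStar_mul hT hS, coeStar_coeStarStar]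
  change _ * (coeStarStar hT x * _) = _
  rw [← mul_assoc, h]

theorem coeStarStar_leftProj (hS : IsOrthodox S) (x : S) :
    coeStarStar hT (leftProj hT x) = coeStarStar hT x :=
  congrArg (coeStar hT) (coeStar_leftProj hT hS x)

theorem coeStarStar_rightProj (hS : IsOrthodox S) (x : S) :
    coeStarStar hT (rightProj hT x) = coeStarStar hT x :=
  congrArg (coeStar hT) (coeStar_rightProj hT hS x)

theorem leftProj_leftProj (hS : IsOrthodox S) (x : S) :
    leftProj hT (leftProj hT x) = leftProj hT x := by
  have h := (isInverseOf_coeStar_coeStarStar hT x).1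
  rw [leftProj, coeStar_leftProj hT hS, coeStarStar_leftProj hT hS, leftProj]
  grind

theorem rightProj_rightProj (hS : IsOrthodox S) (x : S) :
    rightProj hT (rightProj hT x) = rightProj hT x := by
  have h := (isInverseOf_coeStar_coeStarStar hT x).1
  rw [rightProj, coeStar_rightProj hT hS, coeStarStar_rightProj hT hS, rightProj]
  grind

/-- This gives injectivity of the decomposition: the two components determine `x`, since `x⁰` is
also the `⁰` of either component. -/
theorem leftProj_mul_coeStar_mul_rightProj (x : S) :
    leftProj hT x * coeStar hT x * rightProj hT x = x := by
  have h := isInverseOf_coeStar_coeStarStar hT x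
  have h1 := h.1
  have h2 := h.2
  have h3 := (coeStar_spec hT x).1
  unfold leftProj rightProj
  grind

/-- Writing `x = x x⁰ x` exposes `x⁰(xy)y⁰`, where `xy` may be replaced by `x⁰⁰y⁰⁰`; the rest
collapses because `y⁰x⁰` is an inverse of `x⁰⁰y⁰⁰`. -/
theorem leftProj_mul (hS : IsOrthodox S) (x y : S) :
    leftProj hT (x * y) = leftProj hT x * coeStarStar hT y := by
  have hx := (coeStar_spec hT x).1
  have h1 := mul_mul_eq_mul_coeStarStar_mul hT hS (coeStar_mem hT x) (coeStar_mem hT y) (x * y)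
  have h2 := (isInverseOf_coeStar_coeStarStar hT (x * y)).1
  unfold leftProj
  rw [coeStarStar_mul hT hS] at h1 h2 ⊢
  rw [coeStar_mul hT hS] at h2 ⊢
  calc x * y * (coeStar hT y * coeStar hT x) * (coeStarStar hT x * coeStarStar hT y)
      = x * (coeStar hT x * (x * y) * coeStar hT y) * coeStar hT x *
          (coeStarStar hT x * coeStarStar hT y) := by grind
    _ = x * coeStar hT x * (coeStarStar hT x * coeStarStar hT y * (coeStar hT y * coeStar hT x) *
          (coeStarStar hT x * coeStarStar hT y)) := by rw [h1]; simp only [mul_assoc]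
    _ = _ := by rw [h2]; simp only [mul_assoc]

theorem rightProj_mul (hS : IsOrthodox S) (x y : S) :
    rightProj hT (x * y) = coeStarStar hT x * rightProj hT y := by
  have hy := (coeStar_spec hT y).1
  have h1 := mul_mul_eq_mul_coeStarStar_mul hT hS (coeStar_mem hT x) (coeStar_mem hT y) (x * y)
  have h2 := (isInverseOf_coeStar_coeStarStar hT (x * y)).1
  unfold rightProj
  rw [coeStarStar_mul hT hS] at h1 h2 ⊢
  rw [coeStar_mul hT hS] at h2 ⊢
  calc coeStarStar hT x * coeStarStar hT y * (coeStar hT y * coeStar hT x) * (x * y)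
      = coeStarStar hT x * coeStarStar hT y * coeStar hT y *
          (coeStar hT x * (x * y) * coeStar hT y) * y := by grind
    _ = coeStarStar hT x * coeStarStar hT y * (coeStar hT y * coeStar hT x) *
          (coeStarStar hT x * coeStarStar hT y) * coeStar hT y * y := by
        rw [h1]; simp only [mul_assoc]
    _ = _ := by rw [h2]; simp only [mul_assoc]

/-- If `x = x x⁰ x⁰⁰` and `y = y y⁰ y⁰⁰`, then `x y = x y⁰⁰`. -/
theorem mul_eq_mul_coeStarStar (hS : IsOrthodox S) {x y : S} (hx : leftProj hT x = x)
    (hy : leftProj hT y = y) : x * y = x * coeStarStar hT y := by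
  have h1 := mul_mul_eq_mul_coeStarStar_mul hT hS (coeStarStar_mem hT x) (coeStar_mem hT y) y
  have h2 := (isInverseOf_coeStar_coeStarStar hT y).1
  unfold leftProj at hx hy
  grind

/-- If `x = x⁰⁰ x⁰ x` and `y = y⁰⁰ y⁰ y`, then `x y = x⁰⁰ y`. -/
theorem mul_eq_coeStarStar_mul (hS : IsOrthodox S) {x y : S} (hx : rightProj hT x = x)
    (hy : rightProj hT y = y) : x * y = coeStarStar hT x * y := by
  have h1 := mul_mul_eq_mul_coeStarStar_mul hT hS (coeStar_mem hT x) (coeStarStar_mem hT y) x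
  have h2 := (isInverseOf_coeStar_coeStarStar hT x).1
  unfold rightProj at hx hy
  grind

theorem leftProj_of_mem {s : S} (hs : s ∈ S₀) : leftProj hT s = s := by
  rw [leftProj, coeStarStar_of_mem hT hs, (coeStar_spec hT s).1]

theorem rightProj_of_mem {s : S} (hs : s ∈ S₀) : rightProj hT s = s := by
  rw [rightProj, coeStarStar_of_mem hT hs, (coeStar_spec hT s).1]

end

/-- The subsemigroup `{x : x = x x⁰ x⁰⁰}`. -/
def leftPart (hT : IsQuasiIdealInverseTransversal S₀) (hS : IsOrthodox S) : Subsemigroup S where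
  carrier := {x | leftProj hT x = x}
  mul_mem' {x y} hx hy := by
    change leftProj hT x = x at hx
    change leftProj hT (x * y) = x * y
    rw [leftProj_mul hT hS, hx, mul_eq_mul_coeStarStar hT hS hx hy]

/-- The subsemigroup `{x : x = x⁰⁰ x⁰ x}`. -/
def rightPart (hT : IsQuasiIdealInverseTransversal S₀) (hS : IsOrthodox S) : Subsemigroup S where
  carrier := {x | rightProj hT x = x}
  mul_mem' {x y} hx hy := by
    change rightProj hT y = y at hy
    change rightProj hT (x * y) = x * y
    rw [rightProj_mul hT hS, hy, mul_eq_coeStarStar_mul hT hS hx hy]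

/-- `𝓡`- or `𝓛`-related idempotents of an inverse semigroup are equal. -/
theorem IsInverseSemigroup.idem_eq {T : Type*} [Semigroup T] (h : IsInverseSemigroup T) {e f : T}
    (he : IsIdempotentElem e) (hf : IsIdempotentElem f)
    (hef : e * f = f ∧ f * e = e ∨ e * f = e ∧ f * e = f) : e = f := by
  have he' := he.eq
  have hf' := hf.eq
  -- Both `e` and `f` are inverses of `e`.
  refine (h e).unique ⟨by rw [he', he'], by rw [he', he']⟩ ⟨?_, ?_⟩
  · grind
  · grind

theorem GreenR.idem_mul_eq {T : Type*} [Semigroup T] {a e : T} (h : GreenR a e)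
    (he : IsIdempotentElem e) : e * a = a := by
  rcases h with rfl | ⟨⟨u, rfl⟩, -⟩
  · exact he
  · rw [← mul_assoc, he.eq]

theorem GreenL.mul_idem_eq {T : Type*} [Semigroup T] {a e : T} (h : GreenL a e)
    (he : IsIdempotentElem e) : a * e = a := by
  rcases h with rfl | ⟨⟨u, rfl⟩, -⟩
  · exact he
  · rw [mul_assoc, he.eq]


theorem coeStarStar_eq_of_idem (hT : IsQuasiIdealInverseTransversal S₀)
    (hS : IsOrthodox S) {e f : S} (he : IsIdempotentElem e) (hf : IsIdempotentElem f)
    (hef : e * f = f ∧ f * e = e ∨ e * f = e ∧ f * e = f) :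
    coeStarStar hT e = coeStarStar hT f := by
  have hi := isTransversalEmbedding_subtype hT
  refine congrArg Subtype.val (hT.inverse.idem_eq (e := starStar hi e) (f := starStar hi f)
    ?_ ?_ ?_)
  · rw [IsIdempotentElem, ← starStar_mul hi hS, he.eq]
  · rw [IsIdempotentElem, ← starStar_mul hi hS, hf.eq]
  · rw [← starStar_mul hi hS, ← starStar_mul hi hS]
    exact hef.imp (fun h => ⟨congrArg _ h.1, congrArg _ h.2⟩)
      fun h => ⟨congrArg _ h.1, congrArg _ h.2⟩

/-- For `𝓡`-related idempotents `e`, `f` the images under `⁰⁰` are `𝓡`-related in an inverse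
semigroup, so `e⁰⁰ = f⁰⁰`. Since `xy = x y⁰⁰` here, `f = ff = f f⁰⁰ = f e⁰⁰ = fe = e`. -/
theorem isLeftInverse_leftPart (hT : IsQuasiIdealInverseTransversal S₀) (hS : IsOrthodox S) :
    IsLeftInverse (leftPart hT hS) := by
  have hspec : ∀ x : leftPart hT hS, ∃ y : leftPart hT hS, IsInverseOf y x := fun x =>
    ⟨⟨coeStar hT x, leftProj_of_mem hT (coeStar_mem hT x)⟩,
      (isInverseOf_map_iff (f := MulMemClass.subtype (leftPart hT hS)) Subtype.val_injective).1
        (coeStar_spec hT x)⟩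
  refine ⟨fun x => (hspec x).imp fun y hy => hy.1, fun x => ?_⟩
  obtain ⟨y, hy⟩ := hspec x
  refine ⟨x * y, ⟨hy.isIdempotentElem_mul, Or.inr ⟨⟨x, hy.1.symm⟩, ⟨y, rfl⟩⟩⟩, ?_⟩
  rintro f ⟨hf, hxf⟩
  have hfx := hxf.idem_mul_eq hf
  have h1 : f * (x * y) = x * y := by rw [← mul_assoc, hfx]
  have h2 : x * y * f = f := by
    rcases hxf with rfl | ⟨-, ⟨v, rfl⟩⟩
    · exact hy.1
    · rw [← mul_assoc, hy.1]
  have he := hy.isIdempotentElem_mul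
  generalize x * y = e at *
  have hfS := congrArg Subtype.val hf.eq
  have heS := congrArg Subtype.val he.eq
  have h1S := congrArg Subtype.val h1
  have hss := coeStarStar_eq_of_idem hT hS hfS heS
    (Or.inl ⟨congrArg Subtype.val h1, congrArg Subtype.val h2⟩)
  apply Subtype.ext
  rw [← hfS, ← h1S]
  exact (mul_eq_mul_coeStarStar hT hS f.2 f.2).trans
    (hss ▸ (mul_eq_mul_coeStarStar hT hS f.2 e.2).symm)

theorem isRightInverse_rightPart (hT : IsQuasiIdealInverseTransversal S₀) (hS : IsOrthodox S) :
    IsRightInverse (rightPart hT hS) := by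
  have hspec : ∀ x : rightPart hT hS, ∃ y : rightPart hT hS, IsInverseOf y x := fun x =>
    ⟨⟨coeStar hT x, rightProj_of_mem hT (coeStar_mem hT x)⟩,
      (isInverseOf_map_iff (f := MulMemClass.subtype (rightPart hT hS)) Subtype.val_injective).1
        (coeStar_spec hT x)⟩
  refine ⟨fun x => (hspec x).imp fun y hy => hy.1, fun x => ?_⟩
  obtain ⟨y, hy⟩ := hspec x
  have hyx : x * (y * x) = x := by rw [← mul_assoc, hy.1]
  refine ⟨y * x, ⟨hy.symm.isIdempotentElem_mul, Or.inr ⟨⟨x, hyx.symm⟩, ⟨y, rfl⟩⟩⟩, ?_⟩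
  rintro f ⟨hf, hxf⟩
  have hfx := hxf.mul_idem_eq hf
  have h1 : y * x * f = y * x := by rw [mul_assoc, hfx]
  have h2 : f * (y * x) = f := by
    rcases hxf with rfl | ⟨-, ⟨v, rfl⟩⟩
    · exact hyx
    · rw [mul_assoc, hyx]
  have he := hy.symm.isIdempotentElem_mul
  generalize y * x = e at *
  have hfS := congrArg Subtype.val hf.eq
  have heS := congrArg Subtype.val he.eq
  have h1S := congrArg Subtype.val h1
  have hss := coeStarStar_eq_of_idem hT hS hfS heS
    (Or.inr ⟨congrArg Subtype.val h2, congrArg Subtype.val h1⟩)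
  apply Subtype.ext
  rw [← hfS, ← h1S]
  exact (mul_eq_coeStarStar_mul hT hS f.2 f.2).trans
    (hss ▸ (mul_eq_coeStarStar_mul hT hS e.2 f.2).symm)

theorem exists_mulEquiv_spinedProduct (hT : IsQuasiIdealInverseTransversal S₀)
    (hS : IsOrthodox S) (hL : S₀ ≤ leftPart hT hS) (hR : S₀ ≤ rightPart hT hS) :
    letI := spinedSemigroup (isLeftInverse_leftPart hT hS).isOrthodox
      (isRightInverse_rightPart hT hS).isOrthodox
      (isTransversalEmbedding_inclusion hT hL) (isTransversalEmbedding_inclusion hT hR)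
    ∃ φ : S ≃* SpinedProduct (isTransversalEmbedding_inclusion hT hL)
        (isTransversalEmbedding_inclusion hT hR),
      ∀ s : S₀, (φ s).val = (Subsemigroup.inclusion hL s, Subsemigroup.inclusion hR s) := by
  have hi := isTransversalEmbedding_inclusion hT hL
  have hj := isTransversalEmbedding_inclusion hT hR
  let := spinedSemigroup (isLeftInverse_leftPart hT hS).isOrthodox
    (isRightInverse_rightPart hT hS).isOrthodox hi hj
  have ext_iff : ∀ p q : SpinedProduct hi hj,
      p = q ↔ (p.val.1 : S) = q.val.1 ∧ (p.val.2 : S) = q.val.2 := fun p q => by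
    rw [Subtype.ext_iff, Prod.ext_iff, Subtype.ext_iff, Subtype.ext_iff]
  let φ : S → SpinedProduct hi hj := fun x =>
    ⟨(⟨leftProj hT x, leftProj_leftProj hT hS x⟩, ⟨rightProj hT x, rightProj_rightProj hT hS x⟩), by
      apply Subtype.ext
      rw [coe_star_inclusion hT, coe_star_inclusion hT]
      exact (coeStar_leftProj hT hS x).trans (coeStar_rightProj hT hS x).symm⟩
  have φ_mul : ∀ x y, φ (x * y) = φ x * φ y := by
    intro x y
    rw [ext_iff]
    refine ⟨(leftProj_mul hT hS x y).trans ?_, (rightProj_mul hT hS x y).trans ?_⟩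
    · change _ = leftProj hT x * (starStar hi _).val
      rw [coe_starStar_inclusion hT, coeStarStar_leftProj hT hS]
    · change _ = (starStar hj _).val * rightProj hT y
      rw [coe_starStar_inclusion hT, coeStarStar_rightProj hT hS]
  have φ_inj : Function.Injective φ := by
    intro x y hxy
    obtain ⟨h1, h2⟩ := (ext_iff _ _).1 hxy
    change leftProj hT x = leftProj hT y at h1
    change rightProj hT x = rightProj hT y at h2
    have h3 := congrArg (coeStar hT) h1
    rw [coeStar_leftProj hT hS, coeStar_leftProj hT hS] at h3
    rw [← leftProj_mul_coeStar_mul_rightProj hT x, h1, h2, h3,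
      leftProj_mul_coeStar_mul_rightProj hT y]
  have φ_surj : Function.Surjective φ := by
    rintro ⟨⟨⟨u, hu⟩, ⟨v, hv⟩⟩, huv⟩
    have huv' : coeStar hT u = coeStar hT v :=
      (coe_star_inclusion hT hL ⟨u, hu⟩).symm.trans
        ((congrArg Subtype.val huv).trans (coe_star_inclusion hT hR ⟨v, hv⟩))
    have huv2 : coeStarStar hT u = coeStarStar hT v := congrArg (coeStar hT) huv'
    -- The preimage is dictated by `x = (x x⁰ x⁰⁰) x⁰ (x⁰⁰ x⁰ x)`. Its components are `u u⁰ u⁰⁰ = u`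
    -- and `v⁰⁰ v⁰ v = v`, using `u⁰ = v⁰`.
    refine ⟨u * coeStar hT u * v, (ext_iff _ _).2 ⟨?_, ?_⟩⟩
    · change leftProj hT _ = u
      change leftProj hT u = u at hu
      rw [leftProj_mul hT hS, leftProj_mul hT hS, hu, ← huv2,
        coeStarStar_of_mem hT (coeStar_mem hT u)]
      exact hu
    · change rightProj hT _ = v
      change rightProj hT v = v at hv
      rw [mul_assoc, rightProj_mul hT hS, rightProj_mul hT hS, hv, huv2, huv',
        coeStarStar_of_mem hT (coeStar_mem hT v), ← mul_assoc]
      exact hv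
  refine ⟨MulEquiv.ofBijective (⟨φ, φ_mul⟩ : S →ₙ* SpinedProduct hi hj) ⟨φ_inj, φ_surj⟩,
    fun s => congrArg Subtype.val ((ext_iff (φ s) (spinedDiag hi hj s)).2
      ⟨leftProj_of_mem hT s.2, rightProj_of_mem hT s.2⟩)⟩

end Decomposition

end InvTrans

theorem mainTheorem11 :
    -- the spined product construction
    (∀ (S₀ L R : Type*) [Semigroup S₀] [Semigroup L] [Semigroup R]
      (i : S₀ →ₙ* L) (j : S₀ →ₙ* R)
      (hi : InvTrans.IsTransversalEmbedding i) (hj : InvTrans.IsTransversalEmbedding j),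
      InvTrans.IsLeftInverse L → InvTrans.IsRightInverse R →
      ∃ _sg : Semigroup (InvTrans.SpinedProduct hi hj),
        (∀ p q : InvTrans.SpinedProduct hi hj,
          (p * q).val = InvTrans.spinedMul hi hj p.val q.val) ∧
        InvTrans.IsOrthodox (InvTrans.SpinedProduct hi hj) ∧
        ∃ T : Subsemigroup (InvTrans.SpinedProduct hi hj),
          InvTrans.IsQuasiIdealInverseTransversal T ∧
          ∃ ψ : S₀ ≃* T, ∀ s : S₀, (ψ s).val.val = (i s, j s)) ∧
    -- every orthodox semigroup with a quasi-ideal inverse transversal arises in this way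
    (∀ (S : Type*) [Semigroup S] (S₀ : Subsemigroup S),
      InvTrans.IsOrthodox S → InvTrans.IsQuasiIdealInverseTransversal S₀ →
      ∃ (L R : Subsemigroup S) (hL : S₀ ≤ L) (hR : S₀ ≤ R)
        (hi : InvTrans.IsTransversalEmbedding (Subsemigroup.inclusion hL))
        (hj : InvTrans.IsTransversalEmbedding (Subsemigroup.inclusion hR)),
        InvTrans.IsLeftInverse L ∧ InvTrans.IsRightInverse R ∧
        ∃ _sg : Semigroup (InvTrans.SpinedProduct hi hj),
          (∀ p q : InvTrans.SpinedProduct hi hj,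
            (p * q).val = InvTrans.spinedMul hi hj p.val q.val) ∧
          ∃ φ : S ≃* InvTrans.SpinedProduct hi hj,
            ∀ s : S₀, (φ s).val =
              (Subsemigroup.inclusion hL s, Subsemigroup.inclusion hR s)) := by
  refine ⟨fun S₀ L R _ _ _ i j hi hj hL hR => ?_, fun S _ S₀ hS hT => ?_⟩
  · exact ⟨InvTrans.spinedSemigroup hL.isOrthodox hR.isOrthodox hi hj, fun _ _ => rfl,
      InvTrans.spinedProduct_structure hL hR⟩
  · have hL : S₀ ≤ InvTrans.leftPart hT hS := fun _ hs => InvTrans.leftProj_of_mem hT hs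
    have hR : S₀ ≤ InvTrans.rightPart hT hS := fun _ hs => InvTrans.rightProj_of_mem hT hs
    exact ⟨_, _, hL, hR, InvTrans.isTransversalEmbedding_inclusion hT hL,
      InvTrans.isTransversalEmbedding_inclusion hT hR, InvTrans.isLeftInverse_leftPart hT hS,
      InvTrans.isRightInverse_rightPart hT hS, InvTrans.spinedSemigroup _ _ _ _, fun _ _ => rfl,
      InvTrans.exists_mulEquiv_spinedProduct hT hS hL hR⟩
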